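/- Let $\mathbb C_0=\{s\in\mathbb C:\operatorname{Re}s>0\}$, and let $\mathscr A(\mathbb C_0)$ be the complex Banach space, with the supremum norm on $\mathbb C_0$, of all functions $f:\mathbb C_0\to\mathbb C$ that are uniform limits on $\mathbb C_0$ of a sequence of Dirichlet polynomials $\sum_{n=1}^N a_n n^{-s}$. Let $\mathscr M$ be the set of those $f\in\mathscr A(\mathbb C_0)$ that are represented on some half plane $\{\operatorname{Re}s>\sigma\}$ by a Dirichlet series $\sum_{n\ge1}a_n n^{-s}$ whose abscissa of absolute convergence $\sigma_a=\inf\{\sigma\in\mathbb R:\sum_{n\ge1}|a_n|n^{-\sigma}<\infty\}$ equals $1/2$. **Theorem 1.1.** The set $\mathscr M$ is maximal spaceable in $\mathscr A(\mathbb C_0)$, that is, $\mathscr M\cup\{0\}$ contains a closed vector subspace of $\mathscr A(\mathbb C_0)$ whose dimension (as a cardinal number) equals $\dim\mathscr A(\mathbb C_0)$. More precisely, there is an isometric copy of $\ell_1$ in $\mathscr A(\mathbb C_0)$ contained in $\mathscr M\cup\{0\}$: there is a complex-linear isometry $T:\ell_1\to\mathscr A(\mathbb C_0)$ with $T(\ell_1)\setminus\{0\}\subset\mathscr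 M$. -/

import Mathlib

open Filter Topology BoundedContinuousFunction

noncomputable section

namespace BohrStrip

/-- The open right half plane `ℂ₀ = {s : Re s > 0}`. -/
abbrev RightHalfPlane : Type := {s : ℂ // 0 < s.re}

theorem norm_natCast_cpow_le_one (n : ℕ) (s : RightHalfPlane) :
    ‖((n + 1 : ℕ) : ℂ) ^ (-(s : ℂ))‖ ≤ 1 := by
  rw [Complex.norm_natCast_cpow_of_pos n.succ_pos, Complex.neg_re]
  exact Real.rpow_le_one_of_one_le_of_nonpos (by exact_mod_cast n.succ_pos) (by linarith [s.2])

/-- The function `s ↦ (n + 1)^(-s)` on the right half plane, as a bounded continuous function. -/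
def dirichletMonomial (n : ℕ) : RightHalfPlane →ᵇ ℂ :=
  BoundedContinuousFunction.ofNormedAddCommGroup
    (fun s : RightHalfPlane => ((n + 1 : ℕ) : ℂ) ^ (-(s : ℂ)))
    (Continuous.const_cpow (by fun_prop) (Or.inl (by exact_mod_cast n.succ_ne_zero)))
    1 (norm_natCast_cpow_le_one n)

/-- The Dirichlet polynomials `∑_{n=1}^N aₙ n^(-s)`, as a subspace of the bounded continuous
functions on the right half plane. -/
def dirichletPolynomials : Submodule ℂ (RightHalfPlane →ᵇ ℂ) :=
  Submodule.span ℂ (Set.range dirichletMonomial)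

/-- The space `𝒜(ℂ₀)` of uniform limits on the right half plane of Dirichlet polynomials. It
carries the supremum norm, inherited from the bounded continuous functions. -/
def dirichletAlgebra : Submodule ℂ (RightHalfPlane →ᵇ ℂ) :=
  dirichletPolynomials.topologicalClosure

/-- Sanity check: the members of `dirichletPolynomials` are the finite Dirichlet series. -/
theorem mem_dirichletPolynomials_iff (f : RightHalfPlane →ᵇ ℂ) :
    f ∈ dirichletPolynomials ↔ ∃ (N : ℕ) (a : ℕ → ℂ), ∀ s : RightHalfPlane,
      f s = ∑ n ∈ Finset.Icc 1 N, a n * (n : ℂ) ^ (-(s : ℂ)) := by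
  have key (N : ℕ) (a : ℕ → ℂ) (s : RightHalfPlane) :
      (∑ i ∈ Finset.range N, a (i + 1) • dirichletMonomial i) s
        = ∑ n ∈ Finset.Icc 1 N, a n * (n : ℂ) ^ (-(s : ℂ)) := by
    induction N with
    | zero => simp
    | succ N ih =>
      rw [Finset.sum_range_succ, Finset.sum_Icc_succ_top (by omega), ← ih]
      rfl
  constructor
  · intro hf
    obtain ⟨c, rfl⟩ := (Finsupp.mem_span_range_iff_exists_finsupp).1 hf
    refine ⟨c.support.sup id + 1, fun n => c (n - 1), fun s => ?_⟩
    rw [← key]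
    simp only [Nat.add_sub_cancel]
    rw [Finsupp.sum_of_support_subset c (s := Finset.range (c.support.sup id + 1))]
    · intro i hi
      exact Finset.mem_range.2 (Nat.lt_succ_of_le (Finset.le_sup (f := id) hi))
    · intro i _
      exact zero_smul _ _
  · rintro ⟨N, a, h⟩
    have : f = ∑ i ∈ Finset.range N, a (i + 1) • dirichletMonomial i := by
      ext s
      rw [h s, key]
    rw [this]
    exact Submodule.sum_mem _ fun i _ =>
      Submodule.smul_mem _ _ (Submodule.subset_span ⟨i, rfl⟩)

/-- Sanity check: the members of `dirichletAlgebra` are the uniform limits of sequences of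
Dirichlet polynomials. -/
theorem mem_dirichletAlgebra_iff (f : RightHalfPlane →ᵇ ℂ) :
    f ∈ dirichletAlgebra ↔ ∃ P : ℕ → (RightHalfPlane →ᵇ ℂ),
      (∀ k, P k ∈ dirichletPolynomials) ∧ TendstoUniformly (fun k s => P k s) f atTop := by
  have : f ∈ dirichletAlgebra ↔ f ∈ closure (dirichletPolynomials : Set (RightHalfPlane →ᵇ ℂ)) :=
    Iff.rfl
  rw [this, mem_closure_iff_seq_limit]
  simp only [BoundedContinuousFunction.tendsto_iff_tendstoUniformly, SetLike.mem_coe]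

/-- The function `f` on the right half plane is represented, on some half plane `Re s > σ`, by the
(pointwise convergent) Dirichlet series `∑_{n ≥ 1} aₙ n^(-s)`. The value `a 0` plays no role. -/
def IsRepresentedBy (f : RightHalfPlane → ℂ) (a : ℕ → ℂ) : Prop :=
  ∃ σ : ℝ, ∀ s : RightHalfPlane, σ < (s : ℂ).re →
    Tendsto (fun N : ℕ => ∑ n ∈ Finset.Icc 1 N, a n * (n : ℂ) ^ (-(s : ℂ))) atTop (𝓝 (f s))

/-- The set `ℳ` of those `f ∈ 𝒜(ℂ₀)` whose Dirichlet series has abscissa of absolute convergence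
`σₐ = 1/2`. -/
def maximalStrip : Set dirichletAlgebra :=
  {f | ∃ a : ℕ → ℂ, IsRepresentedBy (f : RightHalfPlane →ᵇ ℂ) a ∧
    LSeries.abscissaOfAbsConv a = ((1 / 2 : ℝ) : EReal)}

universe u v

/-- `Z` is `κ`-spaceable in `E`: the set `Z ∪ {0}` contains a closed subspace of `E` of
(algebraic) dimension `κ`. -/
def IsSpaceable (𝕜 : Type v) {E : Type u} [Field 𝕜] [AddCommGroup E] [Module 𝕜 E]
    [TopologicalSpace E] (Z : Set E) (κ : Cardinal.{u}) : Prop :=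
  ∃ W : Submodule 𝕜 E, IsClosed (W : Set E) ∧ Module.rank 𝕜 W = κ ∧ (W : Set E) ⊆ Z ∪ {0}

/-- `Z` is maximal spaceable in `E`: it is `dim E`-spaceable. -/
def IsMaximalSpaceable (𝕜 : Type v) {E : Type u} [Field 𝕜] [AddCommGroup E] [Module 𝕜 E]
    [TopologicalSpace E] (Z : Set E) : Prop :=
  IsSpaceable 𝕜 Z (Module.rank 𝕜 E)

end BohrStrip

end

/-!
The isometry sends `x ∈ ℓ₁` to `(∑ x m * r_m ^ (-s)) * g(s)`, where `r_m` is the `2 m`-th prime and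
`g = ∑ₖ g_k` is one fixed absolutely convergent sum of Dirichlet polynomials built from the remaining
primes.

The block `g_k` is a form that is linear in each of `k + 1` groups of `q = q_k` variables, the
variables being `p ^ (-s)` for distinct primes `p`. Its coefficients are, up to normalization,
`∏ u (i_l - i_(l+1))` with the quadratic chirp `u r = exp (2πi r² / q)`, `q` odd. The circulant matrix
of the chirp is `√q` times a unitary matrix, so that the form is bounded by `q * √q ^ k` on the
polydisc (`norm_chirpForm_le`). As the constant vectors are eigenvectors of this matrix, the bound
is attained where all variables are `1` (`chirpForm_one`), and `g_k` is scaled to have the value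
`2 ^ (-(k + 1))` there.

*Isometry.* The upper bound is the triangle inequality. By Kronecker's theorem
(`mem_closure_bohrPoint`), the variables `r_m ^ (-s)` can be given the phases that turn
`∑ x m * r_m ^ (-s)` into `‖x‖` while all other `p ^ (-s)` are close to `1` and hence `g` is close to
`∑ 2 ^ (-(k + 1)) = 1`.

*Abscissa.* By unique factorization no two terms of the product have the same frequency
(`freqMul_injective`), so that the absolute series of the image is the product of those of
`∑ x m * r_m ^ (-s)` and of `g`. The coefficients of `g` are square summable, so its series converges
absolutely for `σ > 1/2` by the Cauchy–Schwarz inequality (`summable_coef_freq`). For `σ < 1/2` it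
diverges: the `q ^ (k + 1)` coefficients of `g_k` all have the modulus
`2 ^ (-(k + 1)) * q ^ (-1 - k / 2)`, and by Chebyshev's estimate the frequencies are at most
`q ^ (k + 2)` when `q` is large in terms of `k` (`not_summable_coef_freq`).

*Dimension.* The range of the isometry is closed, and both spaces have continuum dimension.
-/

namespace BohrStrip

/-! ### Kronecker's theorem and the logarithms of the primes -/

open MeasureTheory in
/-- The normalized Haar measure of the torus kills every nontrivial character. -/
theorem integral_mFourier_eq_zero {d : Type*} [Fintype d] {n : d → ℤ} (hn : n ≠ 0) :
    ∫ x : UnitAddTorus d, UnitAddTorus.mFourier n x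
      ∂(Measure.pi fun _ : d => (AddCircle.haarAddCircle : Measure UnitAddCircle)) = 0 := by
  obtain ⟨i, hi⟩ := Function.ne_iff.1 hn
  have h1 : ∫ y : UnitAddCircle, fourier (n i) y ∂AddCircle.haarAddCircle = 0 :=
    integral_eq_zero_of_add_right_eq_neg (μ := AddCircle.haarAddCircle)
      (fourier_add_half_inv_index hi one_pos)
  have h2 := integral_fintype_prod_eq_prod (𝕜 := ℂ) (ι := d) (E := fun _ => UnitAddCircle)
    (μ := fun _ : d => AddCircle.haarAddCircle) (fun i y => fourier (n i) y)
  rw [Finset.prod_eq_zero (Finset.mem_univ i) h1] at h2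
  exact h2

/-- A nontrivial oscillation `t ↦ exp (c i t)` has mean value zero. -/
theorem tendsto_mean_exp {c : ℝ} (hc : c ≠ 0) :
    Tendsto (fun T : ℝ => (T : ℂ)⁻¹ * ∫ t in (0 : ℝ)..T, Complex.exp (c * Complex.I * t))
      atTop (𝓝 0) := by
  have hc' : (c : ℂ) * Complex.I ≠ 0 := by simp [hc]
  refine squeeze_zero_norm' (a := fun T : ℝ => T⁻¹ * (2 / |c|)) ?_ ?_
  · filter_upwards [eventually_gt_atTop 0] with T hT
    rw [integral_exp_mul_complex hc', norm_mul, norm_inv, Complex.norm_real, Real.norm_of_nonneg hT.le,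
      norm_div, norm_mul, Complex.norm_real, Complex.norm_I, mul_one, Real.norm_eq_abs]
    gcongr
    refine (norm_sub_le _ _).trans ?_
    have h : ∀ T : ℝ, ‖Complex.exp (c * Complex.I * T)‖ = 1 := fun T => by
      rw [show (c : ℂ) * Complex.I * T = ((c * T : ℝ) : ℂ) * Complex.I by push_cast; ring,
        Complex.norm_exp_ofReal_mul_I]
    rw [h, h]
    norm_num
  · simpa using tendsto_inv_atTop_zero.mul_const (2 / |c|)

open MeasureTheory in
/-- **Kronecker's theorem.** If the real numbers `l i` are linearly independent over `ℤ`, then the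
line `t ↦ (l i * t)ᵢ` is dense in the torus. A continuous function on the torus vanishing on the
line has vanishing mean along the line; as trigonometric polynomials are dense, that mean is its
Haar integral, so a bump function cannot vanish on the line. -/
theorem dense_range_torus_line {d : Type*} [Fintype d] (l : d → ℝ)
    (hl : ∀ n : d → ℤ, ∑ i, n i * l i = 0 → n = 0) :
    DenseRange fun (t : ℝ) (i : d) => ((l i * t : ℝ) : UnitAddCircle) := by
  set γ : ℝ → UnitAddTorus d := fun t i => ((l i * t : ℝ) : UnitAddCircle) with hγ
  have hγc : Continuous γ := by
    refine continuous_pi fun i => ?_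
    exact (AddCircle.continuous_mk' 1).comp (by fun_prop)
  set ν : Measure (UnitAddTorus d) :=
    Measure.pi fun _ : d => (AddCircle.haarAddCircle : Measure UnitAddCircle) with hν
  have hint : ∀ g : C(UnitAddTorus d, ℂ), Integrable g ν := fun g =>
    g.continuous.integrable_of_hasCompactSupport (HasCompactSupport.of_compactSpace _)
  -- the mean of a trigonometric polynomial along the line is its integral
  have hmean : ∀ g ∈ Submodule.span ℂ (Set.range (UnitAddTorus.mFourier (d := d))),
      Tendsto (fun T : ℝ => (T : ℂ)⁻¹ * ∫ t in (0 : ℝ)..T, g (γ t)) atTop (𝓝 (∫ x, g x ∂ν)) := by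
    intro g hg
    have hii : ∀ (g : C(UnitAddTorus d, ℂ)) (T : ℝ),
        IntervalIntegrable (fun t => g (γ t)) volume 0 T := fun g T =>
      (g.continuous.comp hγc).intervalIntegrable _ _
    induction hg using Submodule.span_induction with
    | mem g hg =>
      obtain ⟨n, rfl⟩ := hg
      by_cases hn : n = 0
      · subst hn
        simp only [UnitAddTorus.mFourier_zero, ContinuousMap.one_apply]
        refine tendsto_const_nhds.congr' ?_
        filter_upwards [eventually_gt_atTop 0] with T hT
        simp [hT.ne']
      · rw [integral_mFourier_eq_zero hn]
        have hc : 2 * Real.pi * ∑ i, n i * l i ≠ 0 :=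
          mul_ne_zero (by positivity) fun h => hn (hl n h)
        refine (tendsto_mean_exp hc).congr fun T => ?_
        congr 2
        funext t
        simp only [UnitAddTorus.mFourier, ContinuousMap.coe_mk, hγ, fourier_coe_apply]
        rw [← Complex.exp_sum]
        congr 1
        push_cast
        rw [Finset.mul_sum, Finset.sum_mul, Finset.sum_mul]
        exact Finset.sum_congr rfl fun i _ => by ring
    | zero => simp
    | add f g _ _ hf hg =>
      simp only [ContinuousMap.add_apply]
      rw [integral_add (hint f) (hint g)]
      refine (hf.add hg).congr fun T => ?_
      rw [intervalIntegral.integral_add (hii f T) (hii g T), mul_add]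
    | smul c f _ hf =>
      simp only [ContinuousMap.smul_apply, smul_eq_mul]
      rw [integral_const_mul]
      refine (hf.const_mul c).congr fun T => ?_
      rw [intervalIntegral.integral_const_mul]
      ring
  -- hence a continuous function vanishing on the line has vanishing integral
  have hzero : ∀ f : C(UnitAddTorus d, ℂ), (∀ t, f (γ t) = 0) → ∫ x, f x ∂ν = 0 := by
    intro f hf
    refine norm_le_zero_iff.1 (le_of_forall_pos_le_add fun ε hε => ?_)
    have hd : f ∈ closure
        (Submodule.span ℂ (Set.range (UnitAddTorus.mFourier (d := d))) : Set _) := by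
      rw [← Submodule.topologicalClosure_coe, UnitAddTorus.span_mFourier_closure_eq_top]
      trivial
    obtain ⟨g, hg, hfg⟩ := Metric.mem_closure_iff.1 hd (ε / 2) (half_pos hε)
    have hfg' : ∀ x, ‖f x - g x‖ ≤ ε / 2 := fun x =>
      ((f - g).norm_coe_le_norm x).trans (by rw [← dist_eq_norm]; exact hfg.le)
    have h1 : ‖∫ x, g x ∂ν‖ ≤ ε / 2 := by
      refine le_of_tendsto (hmean g hg).norm ?_
      filter_upwards [eventually_gt_atTop 0] with T hT
      have h2 : ‖∫ t in (0 : ℝ)..T, g (γ t)‖ ≤ ε / 2 * |T - 0| := by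
        refine intervalIntegral.norm_integral_le_of_norm_le_const fun t _ => ?_
        simpa [hf t] using hfg' (γ t)
      rw [norm_mul, norm_inv, Complex.norm_real, Real.norm_of_nonneg hT.le,
        inv_mul_le_iff₀ hT]
      rw [sub_zero, abs_of_pos hT] at h2
      linarith
    have h2 : ‖∫ x, f x ∂ν - ∫ x, g x ∂ν‖ ≤ ε / 2 := by
      rw [← integral_sub (hint f) (hint g)]
      simpa using norm_integral_le_of_norm_le_const (μ := ν) (Eventually.of_forall hfg')
    calc ‖∫ x, f x ∂ν‖ = ‖(∫ x, f x ∂ν - ∫ x, g x ∂ν) + ∫ x, g x ∂ν‖ := by rw [sub_add_cancel]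
      _ ≤ 0 + ε := (norm_add_le _ _).trans (by linarith)
  intro ω
  by_contra hω
  obtain ⟨f, hf0, hf1, hf01⟩ := exists_continuous_zero_one_of_isClosed
    (isClosed_closure (s := Set.range γ)) (isClosed_singleton (x := ω))
    (Set.disjoint_singleton_right.2 hω)
  have hpos : 0 < ∫ x, f x ∂ν :=
    f.continuous.integral_pos_of_hasCompactSupport_nonneg_nonzero
      (HasCompactSupport.of_compactSpace _) (fun x => (hf01 x).1)
      (x := ω) (by rw [hf1 rfl]; exact one_ne_zero)
  have h0 := hzero ⟨fun x => (f x : ℂ), Complex.continuous_ofReal.comp f.continuous⟩ fun t => by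
    have : f (γ t) = 0 := hf0 (subset_closure ⟨t, rfl⟩)
    simp [this]
  simp only [ContinuousMap.coe_mk] at h0
  rw [integral_complex_ofReal] at h0
  exact hpos.ne' (by exact_mod_cast h0)

/-- The logarithms of distinct primes are linearly independent over `ℤ`, by unique factorization. -/
theorem sum_mul_log_prime_eq_zero {d : Type*} [Fintype d] (p : d → ℕ)
    (hp : ∀ i, (p i).Prime) (hinj : Function.Injective p) (n : d → ℤ)
    (h : ∑ i, n i * Real.log (p i) = 0) : n = 0 := by
  classical
  have hprod : ∏ i, (p i : ℚ) ^ n i = 1 := by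
    have h1 : Real.log ((∏ i, (p i : ℚ) ^ n i : ℚ) : ℝ) = 0 := by
      push_cast
      rw [Real.log_prod fun i _ => zpow_ne_zero _ (by exact_mod_cast (hp i).ne_zero)]
      simpa [Real.log_zpow] using h
    have h2 : (0 : ℚ) < ∏ i, (p i : ℚ) ^ n i :=
      Finset.prod_pos fun i _ => zpow_pos (by exact_mod_cast (hp i).pos) _
    have h3 := Real.eq_one_of_pos_of_log_eq_zero (by exact_mod_cast h2) h1
    exact_mod_cast h3
  funext j
  have : Fact (p j).Prime := ⟨hp j⟩
  have h4 : ∀ s : Finset d, padicValRat (p j) (∏ i ∈ s, (p i : ℚ) ^ n i)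
      = ∑ i ∈ s, if i = j then n i else 0 := by
    intro s
    induction s using Finset.induction_on with
    | empty => simp
    | insert a s ha ih =>
      rw [Finset.prod_insert ha, Finset.sum_insert ha, ← ih,
        padicValRat.mul (zpow_ne_zero _ (by exact_mod_cast (hp a).ne_zero))
          (Finset.prod_ne_zero_iff.2 fun i _ => zpow_ne_zero _ (by exact_mod_cast (hp i).ne_zero)),
        padicValRat.zpow]
      congr 1
      by_cases haj : a = j
      · subst haj
        rw [padicValRat.of_nat, padicValNat_self]
        simp
      · have : Fact (p a).Prime := ⟨hp a⟩
        rw [padicValRat.of_nat, padicValNat_primes fun h => haj (hinj h).symm]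
        simp [haj]
  have h5 := h4 Finset.univ
  rw [hprod] at h5
  simpa using h5.symm

/-- The `n`-th prime number, counting from `0`. -/
noncomputable abbrev prm (n : ℕ) : ℕ := Nat.nth Nat.Prime n

theorem prime_prm (n : ℕ) : (prm n).Prime := Nat.prime_nth_prime n

theorem prm_injective : Function.Injective prm := Nat.nth_injective Nat.infinite_setOfPred_prime

/-- The Bohr point of `s`: the sequence `(p_n ^ (-s))ₙ`. -/
noncomputable def bohrPoint (s : ℂ) (n : ℕ) : ℂ := (prm n : ℂ) ^ (-s)

theorem continuous_bohrPoint : Continuous bohrPoint :=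
  continuous_pi fun n => Continuous.const_cpow (by fun_prop)
    (Or.inl (by exact_mod_cast (prime_prm n).ne_zero))

theorem norm_bohrPoint_le_one {s : ℂ} (hs : 0 ≤ s.re) (n : ℕ) : ‖bohrPoint s n‖ ≤ 1 := by
  rw [bohrPoint, Complex.norm_natCast_cpow_of_pos (prime_prm n).pos, Complex.neg_re]
  exact Real.rpow_le_one_of_one_le_of_nonpos (by exact_mod_cast (prime_prm n).pos) (by linarith)

/-- **Bohr's correspondence.** Every point of the infinite-dimensional torus is a limit of Bohr
points of the right half plane. -/
theorem mem_closure_bohrPoint {ω : ℕ → ℂ} (hω : ∀ n, ‖ω n‖ = 1) :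
    ω ∈ closure (bohrPoint '' {s : ℂ | 0 < s.re}) := by
  have hline : ω ∈ closure (bohrPoint '' {s : ℂ | 0 ≤ s.re}) := by
    rw [mem_closure_iff_nhds]
    intro U hU
    rw [nhds_pi, Filter.mem_pi'] at hU
    obtain ⟨I, V, hV, hVU⟩ := hU
    have hdense := dense_range_torus_line (fun i : I => -(Real.log (prm i) / (2 * Real.pi)))
      (fun n hn => sum_mul_log_prime_eq_zero (fun i : I => prm i) (fun i => prime_prm i)
        (fun i j h => Subtype.ext (prm_injective h)) n (by
          have hpi : (-(2 * Real.pi)) ≠ 0 := by simp [Real.pi_ne_zero]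
          have := congrArg (fun x => x * (-(2 * Real.pi))) hn
          simp only [zero_mul, Finset.sum_mul] at this
          rw [← this]
          refine Finset.sum_congr rfl fun i _ => ?_
          have := Real.pi_ne_zero
          field_simp))
    -- lift `ω` to the additive torus
    have hex : ∀ i : I, ∃ y : UnitAddCircle, fourier 1 y = ω i := fun i => by
      obtain ⟨y, hy⟩ := (AddCircle.homeomorphCircle (T := 1) one_ne_zero).surjective
        ⟨ω i, by simp [Submonoid.unitSphere, hω]⟩
      refine ⟨y, ?_⟩
      rw [AddCircle.homeomorphCircle_apply] at hy
      rw [fourier_one, hy]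
    choose y hy using hex
    have hW : {x : UnitAddTorus I | ∀ i : I, fourier 1 (x i) ∈ V i} ∈ 𝓝 y := by
      rw [Set.ofPred_forall]
      refine Filter.iInter_mem.2 fun i => ?_
      have : ContinuousAt (fun x : UnitAddTorus I => (fourier 1 (x i) : ℂ)) y :=
        ((fourier 1).continuous.comp (continuous_apply i)).continuousAt
      exact this (by simpa only [hy] using hV i)
    obtain ⟨_, hx, ⟨t, rfl⟩⟩ := mem_closure_iff_nhds.1 (hdense y) _ hW
    refine ⟨bohrPoint (t * Complex.I), hVU fun i hi => ?_, _, by simp, rfl⟩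
    have := hx ⟨i, hi⟩
    rw [fourier_coe_apply] at this
    convert this using 1
    rw [bohrPoint, Complex.cpow_def_of_ne_zero (by exact_mod_cast (prime_prm i).ne_zero),
      Complex.natCast_log.symm]
    congr 1
    have := Complex.ofReal_ne_zero.2 Real.pi_ne_zero
    push_cast
    field_simp
  refine closure_minimal ?_ isClosed_closure hline
  rintro _ ⟨s, hs, rfl⟩
  refine image_closure_subset_closure_image continuous_bohrPoint ⟨s, ?_, rfl⟩
  rwa [Complex.closure_setOfPred_lt_re]

/-! ### Growth of the primes -/

/-- Chebyshev's lower bound in the form `x ^ a = o(π(x))` for `a < 1`. -/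
theorem eventually_rpow_lt_primeCounting {a : ℝ} (ha : a < 1) (C : ℝ) :
    ∀ᶠ n : ℕ in atTop, C * (n : ℝ) ^ a < Nat.primeCounting n := by
  set b : ℝ := (1 - a) / 2 with hb
  have hb0 : 0 < b := by rw [hb]; linarith
  have hlog : ∀ᶠ x : ℝ in atTop, ‖Real.log x‖ ≤ 1 * ‖x ^ b‖ :=
    (isLittleO_log_rpow_atTop hb0).bound one_pos
  have h1 : Tendsto (fun x : ℝ => x ^ b) atTop atTop := tendsto_rpow_atTop hb0
  have hlin : ∀ᶠ x : ℝ in atTop, ‖Real.log x‖ ≤ 1 / 8 * ‖x‖ :=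
    Real.isLittleO_log_id_atTop.bound (by norm_num)
  have hx : ∀ᶠ x : ℝ in atTop, C * x ^ a < (x * Real.log 2 - Real.log (x + 1)) / Real.log x := by
    filter_upwards [hlog, hlin, (tendsto_atTop_add_const_right atTop 1 tendsto_id).eventually hlin,
      h1.eventually_gt_atTop (4 * |C|), eventually_gt_atTop 2] with x h2 h3 h4 h5 h6
    have hx0 : 0 < x := by linarith
    have hl : 0 < Real.log x := Real.log_pos (by linarith)
    have hbx : 0 < x ^ b := Real.rpow_pos_of_pos hx0 b
    have hax : 0 < x ^ a := Real.rpow_pos_of_pos hx0 a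
    rw [Real.norm_of_nonneg hl.le, Real.norm_of_nonneg hbx.le, one_mul] at h2
    simp only [id] at h4
    rw [Real.norm_of_nonneg (Real.log_nonneg (by linarith)), Real.norm_of_nonneg (by linarith)] at h4
    rw [lt_div_iff₀ hl]
    have hsplit : x = x ^ a * (x ^ b * x ^ b) := by
      rw [← Real.rpow_add hx0, ← Real.rpow_add hx0, hb]
      ring_nf
      simp
    have hlog2 := Real.log_two_gt_d9
    calc C * x ^ a * Real.log x ≤ |C| * x ^ a * x ^ b := by
          gcongr
          exact le_abs_self C
      _ = x ^ a * (|C| * x ^ b) := by ring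
      _ < x ^ a * (1 / 4 * x ^ b * x ^ b) := by
          gcongr
          linarith
      _ = 1 / 4 * (x ^ a * (x ^ b * x ^ b)) := by ring
      _ = 1 / 4 * x := by rw [← hsplit]
      _ ≤ x * Real.log 2 - Real.log (x + 1) := by nlinarith
  filter_upwards [tendsto_natCast_atTop_atTop.eventually hx] with n hn
  exact hn.trans_le (Chebyshev.pi_ge n)

/-- The `(K q)`-th prime is at most `q ^ (1 + ε)` for large `q`. -/
theorem eventually_prm_mul_le_rpow (K : ℕ) {ε : ℝ} (hε : 0 < ε) :
    ∀ᶠ q : ℕ in atTop, (prm (K * q) : ℝ) ≤ (q : ℝ) ^ (1 + ε) := by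
  have hε1 : 0 < 1 + ε := by linarith
  have hfloor : Tendsto (fun q : ℕ => ⌊(q : ℝ) ^ (1 + ε)⌋₊) atTop atTop :=
    tendsto_nat_floor_atTop.comp ((tendsto_rpow_atTop hε1).comp tendsto_natCast_atTop_atTop)
  have ha : (1 + ε)⁻¹ < 1 := inv_lt_one_of_one_lt₀ (by linarith)
  filter_upwards [hfloor.eventually (eventually_rpow_lt_primeCounting ha (2 * K)),
    eventually_ge_atTop 1] with q hq hq1
  set n := ⌊(q : ℝ) ^ (1 + ε)⌋₊ with hn
  have hq1' : (1 : ℝ) ≤ q := by exact_mod_cast hq1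
  have hn1 : 1 ≤ n := Nat.le_floor (by simpa using Real.one_le_rpow hq1' hε1.le)
  have hqn : (q : ℝ) ≤ 2 * (n : ℝ) ^ (1 + ε)⁻¹ := by
    have h1 : (q : ℝ) ^ (1 + ε) ≤ 2 * n := by
      have := (Nat.lt_floor_add_one ((q : ℝ) ^ (1 + ε))).le
      have : (1 : ℝ) ≤ n := by exact_mod_cast hn1
      linarith
    calc (q : ℝ) = ((q : ℝ) ^ (1 + ε)) ^ (1 + ε)⁻¹ := by
          rw [Real.rpow_rpow_inv (by positivity) hε1.ne']
      _ ≤ (2 * n) ^ (1 + ε)⁻¹ := by gcongr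
      _ = 2 ^ (1 + ε)⁻¹ * (n : ℝ) ^ (1 + ε)⁻¹ := Real.mul_rpow (by norm_num) (by positivity)
      _ ≤ 2 * (n : ℝ) ^ (1 + ε)⁻¹ := by
          gcongr
          exact Real.rpow_le_self_of_one_le (by norm_num) ha.le
  have hcount : K * q < Nat.count Nat.Prime (n + 1) := by
    have : ((K * q : ℕ) : ℝ) < Nat.primeCounting n := by
      push_cast
      refine lt_of_le_of_lt ?_ hq
      nlinarith [Nat.cast_nonneg (α := ℝ) K]
    exact_mod_cast this
  have := Nat.nth_lt_of_lt_count hcount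
  calc (prm (K * q) : ℝ) ≤ n := by exact_mod_cast Nat.lt_succ_iff.1 this
    _ ≤ (q : ℝ) ^ (1 + ε) := Nat.floor_le (by positivity)

/-! ### Homogeneous polynomials with flat coefficients and small supremum norm -/

section Chirp

variable {q : ℕ} [NeZero q]

/-- The quadratic chirp `r ↦ exp (2πi r² / q)` on `ℤ/q`. -/
noncomputable def chirp (r : ZMod q) : ℂ := ZMod.stdAddChar (r ^ 2)

theorem norm_chirp (r : ZMod q) : ‖chirp r‖ = 1 := by
  simp [chirp]

theorem sum_chirp_mul_conj (hq : Odd q) (r r' : ZMod q) :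
    ∑ s, chirp (s - r) * (starRingEnd ℂ) (chirp (s - r')) = if r = r' then (q : ℂ) else 0 := by
  have h2 : IsUnit (2 : ZMod q) := by
    have := (ZMod.isUnit_iff_coprime 2 q).2 (Nat.coprime_two_left.2 hq)
    exact_mod_cast this
  have h : ∀ s : ZMod q, chirp (s - r) * (starRingEnd ℂ) (chirp (s - r'))
      = ZMod.stdAddChar (r ^ 2 - r' ^ 2) * ZMod.stdAddChar (s * (2 * (r' - r))) := by
    intro s
    rw [chirp, chirp, ← AddChar.map_neg_eq_conj, ← AddChar.map_add_eq_mul,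
      ← AddChar.map_add_eq_mul]
    congr 1
    ring
  simp_rw [h, ← Finset.mul_sum]
  rw [AddChar.sum_mulShift _ (ZMod.isPrimitive_stdAddChar q)]
  have h3 : 2 * (r' - r) = 0 ↔ r = r' := by
    rw [h2.mul_right_eq_zero, sub_eq_zero, eq_comm]
  by_cases hr : r = r'
  · simp [hr]
  · simp [hr, h3]

/-- The circulant matrix of the chirp is `√q` times a unitary matrix. -/
theorem sum_norm_sq_chirp_conv (hq : Odd q) (h : ZMod q → ℂ) :
    ∑ r, ‖∑ s, chirp (r - s) * h s‖ ^ 2 = q * ∑ s, ‖h s‖ ^ 2 := by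
  have key : (∑ r, (∑ s, chirp (r - s) * h s) * (starRingEnd ℂ) (∑ s, chirp (r - s) * h s) : ℂ)
      = q * ∑ s, h s * (starRingEnd ℂ) (h s) := by
    simp_rw [map_sum, map_mul, Finset.sum_mul_sum]
    rw [Finset.sum_comm, Finset.mul_sum]
    refine Finset.sum_congr rfl fun s _ => ?_
    rw [Finset.sum_comm]
    have : ∀ s', ∑ r, chirp (r - s) * h s * ((starRingEnd ℂ) (chirp (r - s')) * (starRingEnd ℂ) (h s'))
        = (if s = s' then (q : ℂ) else 0) * (h s * (starRingEnd ℂ) (h s')) := fun s' => by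
      rw [← sum_chirp_mul_conj hq, Finset.sum_mul]
      exact Finset.sum_congr rfl fun r _ => by ring
    simp_rw [this]
    simp
  simp_rw [Complex.mul_conj'] at key
  exact_mod_cast key

/-- The Gauss sum `∑ r, exp (2πi r² / q)`, which is the row sum of the chirp matrix. -/
noncomputable def gauss (q : ℕ) [NeZero q] : ℂ := ∑ r : ZMod q, chirp r

theorem sum_chirp_sub_const (r : ZMod q) : ∑ s, chirp (r - s) = gauss q :=
  Fintype.sum_equiv (Equiv.subLeft r) _ _ fun _ => rfl

theorem norm_gauss_sq (hq : Odd q) : ‖gauss q‖ ^ 2 = q := by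
  have h := sum_norm_sq_chirp_conv hq fun _ => 1
  simp only [mul_one, sum_chirp_sub_const, Finset.sum_const, Finset.card_univ, ZMod.card,
    nsmul_eq_mul, norm_one, one_pow] at h
  exact mul_left_cancel₀ (Nat.cast_ne_zero.2 (NeZero.ne q)) h

theorem norm_gauss (hq : Odd q) : ‖gauss q‖ = √q := by
  rw [← norm_gauss_sq hq, Real.sqrt_sq (norm_nonneg _)]

/-- The coefficient of the monomial `∏ z l (i l)`: a product of chirps along the path `i`. -/
noncomputable def chirpCoeff {k : ℕ} (i : Fin (k + 1) → ZMod q) : ℂ :=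
  ∏ l : Fin k, chirp (i l.castSucc - i l.succ)

theorem norm_chirpCoeff {k : ℕ} (i : Fin (k + 1) → ZMod q) : ‖chirpCoeff i‖ = 1 := by
  simp [chirpCoeff, norm_chirp]

/-- The multilinear form `∑ᵢ c(i) z₀(i₀) ⋯ z_k(i_k) h(i_k)` with the coefficients `chirpCoeff`. -/
noncomputable def chirpForm (k : ℕ) (z : ℕ → ZMod q → ℂ) (h : ZMod q → ℂ) : ℂ :=
  ∑ i : Fin (k + 1) → ZMod q, chirpCoeff i * (∏ l : Fin (k + 1), z l (i l)) * h (i (Fin.last k))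

/-- Summing over the last index multiplies the vector `h` by a diagonal matrix and by the chirp
matrix. -/
theorem chirpForm_succ (k : ℕ) (z : ℕ → ZMod q → ℂ) (h : ZMod q → ℂ) :
    chirpForm (k + 1) z h =
      chirpForm k z fun r => ∑ s, chirp (r - s) * (z (k + 1) s * h s) := by
  rw [chirpForm, ← (Fin.snocEquiv fun _ : Fin (k + 2) => ZMod q).sum_comp, Fintype.sum_prod_type,
    Finset.sum_comm, chirpForm]
  refine Finset.sum_congr rfl fun i _ => ?_
  rw [Finset.mul_sum]
  refine Finset.sum_congr rfl fun s _ => ?_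
  simp only [Fin.snocEquiv, Equiv.coe_fn_mk, chirpCoeff]
  rw [Fin.prod_univ_castSucc, Fin.prod_univ_castSucc (n := k + 1)]
  simp only [Fin.succ_castSucc, Fin.snoc_castSucc, Fin.succ_last, Fin.snoc_last, Fin.val_castSucc,
    Fin.val_last]
  ring

/-- The norm bound on the polydisc: the form is a product of contractions and of `k` copies of the
chirp matrix. -/
theorem norm_chirpForm_le (hq : Odd q) {z : ℕ → ZMod q → ℂ} (hz : ∀ l r, ‖z l r‖ ≤ 1) (k : ℕ)
    (h : ZMod q → ℂ) :
    ‖chirpForm k z h‖ ≤ √q ^ (k + 1) * √(∑ r, ‖h r‖ ^ 2) := by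
  induction k generalizing h with
  | zero =>
    have h0 : chirpForm 0 z h = ∑ r, z 0 r * h r := by
      rw [chirpForm, ← (Equiv.funUnique (Fin 1) (ZMod q)).symm.sum_comp]
      simp [chirpCoeff]
    rw [h0, zero_add, pow_one]
    calc ‖∑ r, z 0 r * h r‖ ≤ ∑ r, 1 * ‖h r‖ := by
          refine (norm_sum_le _ _).trans (Finset.sum_le_sum fun r _ => ?_)
          rw [norm_mul]
          gcongr
          exact hz 0 r
      _ ≤ √(∑ _r : ZMod q, 1 ^ 2) * √(∑ r, ‖h r‖ ^ 2) := Real.sum_mul_le_sqrt_mul_sqrt _ _ _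
      _ = √q * √(∑ r, ‖h r‖ ^ 2) := by simp
  | succ k ih =>
    rw [chirpForm_succ]
    refine (ih _).trans ?_
    rw [sum_norm_sq_chirp_conv hq, Real.sqrt_mul (Nat.cast_nonneg q), ← mul_assoc, ← pow_succ]
    gcongr with r
    rw [norm_mul]
    exact mul_le_of_le_one_left (norm_nonneg _) (hz _ r)

theorem chirpForm_one (k : ℕ) (c : ℂ) :
    chirpForm (q := q) k (fun _ _ => 1) (fun _ => c) = q * gauss q ^ k * c := by
  induction k generalizing c with
  | zero =>
    rw [chirpForm, ← (Equiv.funUnique (Fin 1) (ZMod q)).symm.sum_comp]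
    simp [chirpCoeff]
  | succ k ih =>
    rw [chirpForm_succ]
    simp_rw [one_mul, ← Finset.sum_mul, sum_chirp_sub_const]
    rw [ih]
    ring

end Chirp

/-! ### The blocks and their frequencies -/

theorem exists_blockSize (k : ℕ) : ∃ q : ℕ, Odd q ∧ 2 ^ (k + 1) ≤ q ∧
    (prm (2 * (k + 1) * q) : ℝ) ^ (k + 1) ≤ (q : ℝ) ^ (k + 2) := by
  have hε : (0 : ℝ) < 1 / (k + 1) := by positivity
  obtain ⟨N, hN⟩ := eventually_atTop.1 (eventually_prm_mul_le_rpow (2 * (k + 1)) hε)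
  refine ⟨2 * (N + 2 ^ (k + 1)) + 1, odd_two_mul_add_one _, by linarith [Nat.zero_le N, Nat.two_pow_pos (k + 1)], ?_⟩
  have h := hN (2 * (N + 2 ^ (k + 1)) + 1) (by linarith [Nat.zero_le N, Nat.two_pow_pos (k + 1)])
  set q := 2 * (N + 2 ^ (k + 1)) + 1
  calc (prm (2 * (k + 1) * q) : ℝ) ^ (k + 1) ≤ ((q : ℝ) ^ (1 + 1 / ((k : ℝ) + 1))) ^ (k + 1) := by
        gcongr
    _ = (q : ℝ) ^ (k + 2) := by
        rw [← Real.rpow_natCast, ← Real.rpow_mul (by positivity), ← Real.rpow_natCast]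
        congr 1
        push_cast
        field_simp
        ring

/-- The number `q_k` of variables in each of the `k + 1` groups of the `k`-th block. It is odd, and
so large that the primes used by the block are bounded by `q_k ^ (1 + 1 / (k + 1))`. -/
noncomputable def blockSize (k : ℕ) : ℕ := (exists_blockSize k).choose

theorem odd_blockSize (k : ℕ) : Odd (blockSize k) := (exists_blockSize k).choose_spec.1

theorem two_pow_le_blockSize (k : ℕ) : 2 ^ (k + 1) ≤ blockSize k :=
  (exists_blockSize k).choose_spec.2.1

theorem prm_pow_le_blockSize_pow (k : ℕ) :
    (prm (2 * (k + 1) * blockSize k) : ℝ) ^ (k + 1) ≤ (blockSize k : ℝ) ^ (k + 2) :=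
  (exists_blockSize k).choose_spec.2.2

instance (k : ℕ) : NeZero (blockSize k) := ⟨(odd_blockSize k).pos.ne'⟩

theorem blockSize_pos (k : ℕ) : (0 : ℝ) < blockSize k := Nat.cast_pos.2 (odd_blockSize k).pos

/-- The index of the prime attached to the `r`-th variable of the `l`-th group of the `k`-th block.
Only odd indices occur. -/
noncomputable def varIndex (k l : ℕ) (r : ZMod (blockSize k)) : ℕ :=
  2 * (l * blockSize k + r.val) + 1

theorem varIndex_inj {k l l' : ℕ} {r r' : ZMod (blockSize k)}
    (h : varIndex k l r = varIndex k l' r') : l = l' ∧ r = r' := by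
  have h1 : l * blockSize k + r.val = l' * blockSize k + r'.val := by
    unfold varIndex at h
    omega
  have hpos := (odd_blockSize k).pos
  have hdiv : ∀ (l : ℕ) (r : ZMod (blockSize k)), (l * blockSize k + r.val) / blockSize k = l :=
    fun l r => by
      rw [Nat.add_comm, Nat.add_mul_div_right _ _ hpos, Nat.div_eq_of_lt (ZMod.val_lt r), zero_add]
  have hl : l = l' := by rw [← hdiv l r, h1, hdiv]
  subst hl
  exact ⟨rfl, ZMod.val_injective _ (Nat.add_left_cancel h1)⟩

theorem varIndex_le {k l : ℕ} (hl : l ≤ k) (r : ZMod (blockSize k)) :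
    varIndex k l r ≤ 2 * (k + 1) * blockSize k := by
  have h1 := ZMod.val_lt r
  have h2 : l * blockSize k ≤ k * blockSize k := Nat.mul_le_mul_right _ hl
  unfold varIndex
  nlinarith

/-- The monomials of all blocks: a block number `k` and one variable from each of its groups. -/
abbrev MonomialIndex : Type := Σ k : ℕ, (Fin (k + 1) → ZMod (blockSize k))

/-- The integer whose Dirichlet monomial corresponds to a monomial of a block. -/
noncomputable def freq (j : MonomialIndex) : ℕ :=
  ∏ l : Fin (j.1 + 1), prm (varIndex j.1 l (j.2 l))

/-- The coefficient of a monomial. It is normalized by the value `q * gauss q ^ k` of the chirp form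
at `z = 1` and by the weight `2 ^ (-(k + 1))` of the block. -/
noncomputable def coef (j : MonomialIndex) : ℂ :=
  (1 / 2) ^ (j.1 + 1) * (chirpCoeff j.2 / (blockSize j.1 * gauss (blockSize j.1) ^ j.1))

/-- The frequencies of the product of `∑ x m * z (2 m)` with the blocks. -/
noncomputable def freqMul (j : ℕ × MonomialIndex) : ℕ := prm (2 * j.1) * freq j.2

theorem freq_pos (j : MonomialIndex) : 0 < freq j :=
  Finset.prod_pos fun _ _ => (prime_prm _).pos

theorem freqMul_pos (j : ℕ × MonomialIndex) : 0 < freqMul j :=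
  Nat.mul_pos (prime_prm _).pos (freq_pos _)

theorem norm_coef (j : MonomialIndex) :
    ‖coef j‖ = (1 / 2) ^ (j.1 + 1) / (blockSize j.1 * √(blockSize j.1) ^ j.1) := by
  rw [coef, norm_mul, norm_div, norm_chirpCoeff, norm_mul, norm_pow, norm_pow,
    norm_gauss (odd_blockSize _)]
  simp [div_eq_mul_inv]

theorem prod_prm_injective {S S' : Finset ℕ} (h : ∏ i ∈ S, prm i = ∏ i ∈ S', prm i) : S = S' := by
  have key : ∀ S : Finset ℕ, (∏ i ∈ S, prm i).primeFactors = S.image prm := fun S => by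
    rw [← Nat.primeFactors_prod (s := S.image prm), Finset.prod_image prm_injective.injOn]
    intro p hp
    obtain ⟨i, _, rfl⟩ := Finset.mem_image.1 hp
    exact prime_prm i
  exact Finset.image_injective prm_injective (by rw [← key, ← key, h])

/-- Distinct monomials have distinct frequencies, by unique factorization. -/
theorem freqMul_injective : Function.Injective freqMul := by
  have hinj : ∀ j : MonomialIndex,
      Function.Injective fun l : Fin (j.1 + 1) => varIndex j.1 l (j.2 l) :=
    fun j l l' h => Fin.ext (varIndex_inj h).1
  set V : MonomialIndex → Finset ℕ := fun j =>
    Finset.univ.image fun l : Fin (j.1 + 1) => varIndex j.1 l (j.2 l) with hV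
  have hmemV : ∀ (j : MonomialIndex) (n : ℕ),
      n ∈ V j ↔ ∃ l : Fin (j.1 + 1), varIndex j.1 l (j.2 l) = n := fun j n => by simp [hV]
  have hnot : ∀ (m : ℕ) (j : MonomialIndex), 2 * m ∉ V j := fun m j h => by
    obtain ⟨l, hl⟩ := (hmemV _ _).1 h
    unfold varIndex at hl
    omega
  have hfreq : ∀ j : ℕ × MonomialIndex, freqMul j = ∏ i ∈ insert (2 * j.1) (V j.2), prm i :=
    fun j => by
      rw [Finset.prod_insert (hnot _ _), Finset.prod_image (hinj j.2).injOn]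
      rfl
  rintro ⟨m, j⟩ ⟨m', j'⟩ h
  rw [hfreq, hfreq] at h
  have hS := prod_prm_injective h
  dsimp only at hS
  have hm : m = m' := by
    have : 2 * m ∈ insert (2 * m') (V j') := hS ▸ Finset.mem_insert_self _ _
    rcases Finset.mem_insert.1 this with h | h
    · omega
    · exact absurd h (hnot _ _)
  subst hm
  have hVV : V j = V j' := by
    rw [← Finset.erase_insert (hnot m j), hS, Finset.erase_insert (hnot m j')]
  have hcard : ∀ j, (V j).card = j.1 + 1 := fun j => by
    rw [hV, Finset.card_image_of_injective _ (hinj j), Finset.card_univ, Fintype.card_fin]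
  obtain ⟨k, i⟩ := j
  obtain ⟨k', i'⟩ := j'
  have hk : k = k' := by
    have h1 := hcard ⟨k, i⟩
    rw [hVV, hcard] at h1
    simpa using h1.symm
  subst hk
  have hi : i = i' := by
    funext l
    have : varIndex k l (i l) ∈ V ⟨k, i'⟩ := hVV ▸ (hmemV _ _).2 ⟨l, rfl⟩
    obtain ⟨l', hl'⟩ := (hmemV _ _).1 this
    obtain ⟨h1, h2⟩ := varIndex_inj hl'
    rw [Fin.ext h1] at h2
    exact h2.symm
  rw [hi]

theorem freq_injective : Function.Injective freq := fun j j' h => by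
  have : freqMul (0, j) = freqMul (0, j') := by rw [freqMul, freqMul, h]
  exact (Prod.ext_iff.1 (freqMul_injective this)).2

theorem freq_le (j : MonomialIndex) : (freq j : ℝ) ≤ (blockSize j.1 : ℝ) ^ (j.1 + 2) := by
  refine le_trans ?_ (prm_pow_le_blockSize_pow j.1)
  have : freq j ≤ ∏ _l : Fin (j.1 + 1), prm (2 * (j.1 + 1) * blockSize j.1) :=
    Finset.prod_le_prod' fun l _ =>
      (Nat.nth_strictMono Nat.infinite_setOfPred_prime).monotone
        (varIndex_le (Nat.lt_succ_iff.1 l.2) _)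
  rw [Finset.prod_const, Finset.card_univ, Fintype.card_fin] at this
  exact_mod_cast this

/-! ### Absolute convergence of the blocks -/

/-- The coefficients are square summable: the `k`-th block has `q ^ (k + 1)` of them, each of
modulus `2 ^ (-(k + 1)) * q ^ (-1 - k / 2)`. -/
theorem summable_norm_coef_sq : Summable fun j => ‖coef j‖ ^ 2 := by
  rw [summable_sigma_of_nonneg fun _ => by positivity]
  refine ⟨fun k => Summable.of_finite, ?_⟩
  refine Summable.of_nonneg_of_le (fun k => tsum_nonneg fun _ => by positivity) (fun k => ?_)
    (summable_geometric_of_lt_one (r := 1 / 4) (by norm_num) (by norm_num))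
  have hq := blockSize_pos k
  have hq1 : (1 : ℝ) ≤ blockSize k := by exact_mod_cast (odd_blockSize k).pos
  simp_rw [norm_coef]
  rw [tsum_fintype, Finset.sum_const, Finset.card_univ, Fintype.card_fun, ZMod.card,
    Fintype.card_fin, nsmul_eq_mul, div_pow, mul_pow, ← pow_mul √_, mul_comm k 2, pow_mul √_,
    Real.sq_sqrt hq.le, ← pow_mul, mul_comm (k + 1) 2, pow_mul]
  push_cast
  rw [mul_div_assoc', div_le_iff₀ (by positivity)]
  calc (blockSize k : ℝ) ^ (k + 1) * ((1 / 2) ^ 2) ^ (k + 1)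
      = (1 / 4) ^ (k + 1) * (blockSize k * blockSize k ^ k) * 1 := by norm_num; ring
    _ ≤ (1 / 4) ^ k * (blockSize k * blockSize k ^ k) * blockSize k := by
        gcongr ?_ * _ * ?_
        exact pow_le_pow_of_le_one (by norm_num) (by norm_num) (Nat.le_succ k)
    _ = (1 / 4) ^ k * (blockSize k ^ 2 * blockSize k ^ k) := by ring

theorem summable_coef_freq {σ : ℝ} (hσ : 1 / 2 < σ) :
    Summable fun j => ‖coef j‖ * (freq j : ℝ) ^ (-σ) := by
  have h1 : Summable fun j => (freq j : ℝ) ^ (-(2 * σ)) :=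
    (Real.summable_nat_rpow.2 (by linarith : -(2 * σ) < -1)).comp_injective freq_injective
  refine Summable.of_nonneg_of_le (fun j => by positivity) (fun j => ?_)
    (summable_norm_coef_sq.add h1)
  have h2 : (freq j : ℝ) ^ (-(2 * σ)) = ((freq j : ℝ) ^ (-σ)) ^ 2 := by
    rw [← Real.rpow_natCast, ← Real.rpow_mul (by positivity)]
    congr 1
    push_cast
    ring
  rw [h2]
  have h3 : 0 ≤ (freq j : ℝ) ^ (-σ) := by positivity
  nlinarith [sq_nonneg (‖coef j‖ - (freq j : ℝ) ^ (-σ)), norm_nonneg (coef j)]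

/-- The `k`-th block contributes at least `2 ^ (-(k + 1)) * q ^ (k / 2 - (k + 2) * σ)`, which does
not tend to zero as `q ≥ 2 ^ (k + 1)`. -/
theorem not_summable_coef_freq {σ : ℝ} (hσ0 : 0 ≤ σ) (hσ : σ < 1 / 2) :
    ¬ Summable fun j => ‖coef j‖ * (freq j : ℝ) ^ (-σ) := by
  intro h
  have h0 := h.sigma.tendsto_atTop_zero
  have hlarge : ∀ᶠ k : ℕ in atTop, 1 + 2 * σ ≤ k * (1 / 2 - σ) :=
    (tendsto_natCast_atTop_atTop.atTop_mul_const (by linarith : 0 < 1 / 2 - σ)).eventually_ge_atTop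
      (1 + 2 * σ)
  obtain ⟨k, hk, hk1⟩ := (hlarge.and (h0.eventually (gt_mem_nhds one_pos))).exists
  refine absurd hk1 (not_lt.2 ?_)
  have hq := blockSize_pos k
  have hq1 : (1 : ℝ) ≤ blockSize k := by exact_mod_cast (odd_blockSize k).pos
  have hq2 : (2 : ℝ) ^ (k + 1) ≤ blockSize k := by exact_mod_cast two_pow_le_blockSize k
  set q : ℝ := (blockSize k : ℝ) with hqdef
  have hterm : ∀ i : Fin (k + 1) → ZMod (blockSize k),
      (1 / 2) ^ (k + 1) / (q * √q ^ k) * q ^ (-((k + 2) * σ))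
        ≤ ‖coef ⟨k, i⟩‖ * (freq ⟨k, i⟩ : ℝ) ^ (-σ) := fun i => by
    rw [norm_coef]
    refine mul_le_mul_of_nonneg_left ?_ (by positivity)
    have h1 : q ^ (-((k + 2) * σ)) = (q ^ (k + 2)) ^ (-σ) := by
      rw [← Real.rpow_natCast, ← Real.rpow_mul hq.le]
      congr 1
      push_cast
      ring
    rw [h1]
    exact Real.rpow_le_rpow_of_nonpos (by exact_mod_cast freq_pos _) (freq_le ⟨k, i⟩) (by linarith)
  rw [tsum_fintype]
  calc (1 : ℝ) = (1 / 2) ^ (k + 1) * 2 ^ (k + 1) := by rw [← mul_pow]; norm_num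
    _ ≤ (1 / 2) ^ (k + 1) * q ^ (1 : ℝ) := by rw [Real.rpow_one]; gcongr
    _ ≤ (1 / 2) ^ (k + 1) * q ^ ((k : ℝ) / 2 - (k + 2) * σ) := by
        refine mul_le_mul_of_nonneg_left ?_ (by positivity)
        exact Real.rpow_le_rpow_of_exponent_le hq1 (by linarith)
    _ = ∑ _i : Fin (k + 1) → ZMod (blockSize k),
          (1 / 2) ^ (k + 1) / (q * √q ^ k) * q ^ (-((k + 2) * σ)) := by
        rw [Finset.sum_const, Finset.card_univ, Fintype.card_fun, ZMod.card, Fintype.card_fin,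
          nsmul_eq_mul, sub_eq_add_neg, Real.rpow_add hq]
        have h1 : q ^ ((k : ℝ) / 2) = √q ^ k := by
          rw [Real.sqrt_eq_rpow, ← Real.rpow_natCast, ← Real.rpow_mul hq.le]
          congr 1
          ring
        have h2 : q ^ (k + 1) = q * (√q ^ k * √q ^ k) := by
          rw [← mul_pow, Real.mul_self_sqrt hq.le]
          ring
        have h3 : √q ^ k ≠ 0 := by positivity
        rw [h1]
        push_cast
        rw [← hqdef, h2]
        field_simp
    _ ≤ _ := Finset.sum_le_sum fun i _ => hterm i

/-! ### The blocks as functions on the polydisc -/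

/-- The closed unit polydisc in infinitely many variables. -/
def polydisc : Set (ℕ → ℂ) := {z | ∀ n, ‖z n‖ ≤ 1}

theorem isClosed_polydisc : IsClosed polydisc := by
  rw [polydisc, Set.ofPred_forall]
  exact isClosed_iInter fun n => isClosed_le (continuous_apply n).norm continuous_const

/-- The `k`-th block as a polynomial in the variables `z n`. -/
noncomputable def blockPoly (k : ℕ) (z : ℕ → ℂ) : ℂ :=
  ∑ i : Fin (k + 1) → ZMod (blockSize k),
    coef ⟨k, i⟩ * ∏ l : Fin (k + 1), z (varIndex k l (i l))

theorem blockPoly_eq (k : ℕ) (z : ℕ → ℂ) :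
    blockPoly k z = (1 / 2) ^ (k + 1) / (blockSize k * gauss (blockSize k) ^ k) *
      chirpForm k (fun l r => z (varIndex k l r)) fun _ => 1 := by
  rw [blockPoly, chirpForm, Finset.mul_sum]
  refine Finset.sum_congr rfl fun i _ => ?_
  rw [coef]
  ring

theorem norm_blockPoly_le (k : ℕ) {z : ℕ → ℂ} (hz : z ∈ polydisc) :
    ‖blockPoly k z‖ ≤ (1 / 2) ^ (k + 1) := by
  have hq := blockSize_pos k
  have h := norm_chirpForm_le (odd_blockSize k) (z := fun l r => z (varIndex k l r))
    (fun _ _ => hz _) k fun _ => 1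
  simp only [norm_one, one_pow, Finset.sum_const, Finset.card_univ, ZMod.card, nsmul_eq_mul,
    mul_one] at h
  rw [blockPoly_eq, norm_mul, norm_div, norm_mul, norm_pow, norm_pow,
    norm_gauss (odd_blockSize _), Complex.norm_natCast, norm_div, norm_one, Complex.norm_ofNat]
  calc (1 / 2) ^ (k + 1) / (blockSize k * √(blockSize k) ^ k) * ‖chirpForm k _ _‖
      ≤ (1 / 2) ^ (k + 1) / (blockSize k * √(blockSize k) ^ k) *
          (√(blockSize k) ^ (k + 1) * √(blockSize k)) := by gcongr
    _ = (1 / 2) ^ (k + 1) / (blockSize k * √(blockSize k) ^ k) *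
          (√(blockSize k) * √(blockSize k) * √(blockSize k) ^ k) := by ring
    _ = (1 / 2) ^ (k + 1) := by
        rw [Real.mul_self_sqrt hq.le, div_mul_cancel₀ _ (by positivity)]

/-- The bound for the block is attained where all its variables equal `1`. -/
theorem blockPoly_eq_of_forall_odd (k : ℕ) {z : ℕ → ℂ} (hz : ∀ n, z (2 * n + 1) = 1) :
    blockPoly k z = (1 / 2) ^ (k + 1) := by
  have hg : gauss (blockSize k) ≠ 0 := by
    rw [← norm_ne_zero_iff, norm_gauss (odd_blockSize k)]
    exact (Real.sqrt_pos.2 (blockSize_pos k)).ne'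
  have hq : (blockSize k : ℂ) ≠ 0 := by exact_mod_cast (blockSize_pos k).ne'
  have h : (fun (l : ℕ) (r : ZMod (blockSize k)) => z (varIndex k l r)) = fun _ _ => 1 := by
    funext l r
    exact hz _
  rw [blockPoly_eq, h, chirpForm_one, mul_one, div_mul_cancel₀]
  exact mul_ne_zero hq (pow_ne_zero _ hg)

theorem continuous_blockPoly (k : ℕ) : Continuous (blockPoly k) := by
  unfold blockPoly
  fun_prop

theorem summable_half_pow_succ : Summable fun k : ℕ => (1 / 2 : ℝ) ^ (k + 1) :=
  (summable_nat_add_iff 1).2 summable_geometric_two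

theorem tsum_half_pow_succ : ∑' k : ℕ, (1 / 2 : ℝ) ^ (k + 1) = 1 := by
  have := summable_geometric_two.sum_add_tsum_nat_add 1
  rw [tsum_geometric_two] at this
  norm_num at this ⊢
  linarith

/-- The sum of all blocks. -/
noncomputable def blockSum (z : ℕ → ℂ) : ℂ := ∑' k, blockPoly k z

/-- The linear function with coefficients `x` in the even-indexed variables. -/
noncomputable def evenForm (x : ℕ → ℂ) (z : ℕ → ℂ) : ℂ := ∑' m, x m * z (2 * m)

theorem continuousOn_blockSum : ContinuousOn blockSum polydisc :=
  continuousOn_tsum (fun k => (continuous_blockPoly k).continuousOn) summable_half_pow_succ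
    fun k _ hz => norm_blockPoly_le k hz

theorem continuousOn_evenForm {x : ℕ → ℂ} (hx : Summable fun m => ‖x m‖) :
    ContinuousOn (evenForm x) polydisc := by
  refine continuousOn_tsum (fun m => by fun_prop) hx fun m z hz => ?_
  rw [norm_mul]
  exact mul_le_of_le_one_right (norm_nonneg _) (hz _)

/-- On the polydisc, the product of the two functions attains the value `∑ ‖x m‖`: the phases of the
even-indexed variables are at our disposal once the odd-indexed ones are set to `1`. -/
theorem exists_evenForm_mul_blockSum_eq (x : ℕ → ℂ) :
    ∃ ω : ℕ → ℂ, (∀ n, ‖ω n‖ = 1) ∧ evenForm x ω * blockSum ω = (∑' m, ‖x m‖ : ℝ) := by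
  have hphase : ∀ c : ℂ, ∃ w : ℂ, ‖w‖ = 1 ∧ c * w = (‖c‖ : ℂ) := fun c => by
    by_cases hc : c = 0
    · exact ⟨1, by simp, by simp [hc]⟩
    · have hc' : (‖c‖ : ℂ) ≠ 0 := by simpa using hc
      refine ⟨‖c‖ / c, by simp [hc], by field_simp⟩
  choose w hw1 hw2 using hphase
  refine ⟨fun n => if Even n then w (x (n / 2)) else 1, fun n => ?_, ?_⟩
  · dsimp only
    split_ifs <;> simp [hw1]
  · have h1 : blockSum (fun n => if Even n then w (x (n / 2)) else 1) = 1 := by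
      refine Eq.trans ?_ (congrArg Complex.ofReal tsum_half_pow_succ)
      rw [blockSum, Complex.ofReal_tsum]
      refine tsum_congr fun k => ?_
      rw [blockPoly_eq_of_forall_odd k fun n => by simp]
      push_cast
      rfl
    rw [h1, mul_one, evenForm, Complex.ofReal_tsum]
    refine tsum_congr fun m => ?_
    simp [hw2]

/-- By Bohr's correspondence, a bound along the right half plane is a bound for `∑ ‖x m‖`. -/
theorem tsum_norm_le_of_forall_bohrPoint {x : ℕ → ℂ} (hx : Summable fun m => ‖x m‖) {C : ℝ}
    (hC : ∀ s : ℂ, 0 < s.re → ‖evenForm x (bohrPoint s) * blockSum (bohrPoint s)‖ ≤ C) :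
    ∑' m, ‖x m‖ ≤ C := by
  obtain ⟨ω, hω, hval⟩ := exists_evenForm_mul_blockSum_eq x
  have hcl : IsClosed (polydisc ∩ {z | ‖evenForm x z * blockSum z‖ ≤ C}) :=
    ((continuousOn_evenForm hx).mul continuousOn_blockSum).norm.preimage_isClosed_of_isClosed
      isClosed_polydisc isClosed_Iic
  have hmem := closure_minimal (t := polydisc ∩ {z | ‖evenForm x z * blockSum z‖ ≤ C})
    (by
      rintro _ ⟨s, hs, rfl⟩
      exact ⟨norm_bohrPoint_le_one (le_of_lt hs), hC s hs⟩) hcl (mem_closure_bohrPoint hω)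
  have h := hmem.2
  rw [Set.mem_ofPred_eq, hval, Complex.norm_real] at h
  exact (le_abs_self _).trans h

/-! ### The isometry -/

theorem natCast_prod_cpow {ι : Type*} (s : Finset ι) (f : ι → ℕ) (w : ℂ) :
    ((∏ i ∈ s, f i : ℕ) : ℂ) ^ w = ∏ i ∈ s, (f i : ℂ) ^ w := by
  classical
  induction s using Finset.induction_on with
  | empty => simp
  | insert a s ha ih =>
    rw [Finset.prod_insert ha, Finset.prod_insert ha, ← ih, Nat.cast_mul,
      Complex.natCast_mul_natCast_cpow]

theorem freq_cpow (j : MonomialIndex) (s : ℂ) :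
    (freq j : ℂ) ^ (-s) = ∏ l : Fin (j.1 + 1), bohrPoint s (varIndex j.1 l (j.2 l)) :=
  natCast_prod_cpow _ _ _

theorem freqMul_cpow (j : ℕ × MonomialIndex) (s : ℂ) :
    (freqMul j : ℂ) ^ (-s) = bohrPoint s (2 * j.1) * (freq j.2 : ℂ) ^ (-s) := by
  rw [freqMul, Nat.cast_mul, Complex.natCast_mul_natCast_cpow]
  rfl

/-- The Dirichlet polynomial `r ^ (-s) * (k-th block)`, where `r` is the `2 m`-th prime. -/
noncomputable def blockFun (m k : ℕ) : RightHalfPlane →ᵇ ℂ :=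
  ∑ i : Fin (k + 1) → ZMod (blockSize k),
    coef ⟨k, i⟩ • dirichletMonomial (freqMul (m, ⟨k, i⟩) - 1)

theorem blockFun_mem (m k : ℕ) : blockFun m k ∈ dirichletPolynomials :=
  Submodule.sum_mem _ fun _ _ => Submodule.smul_mem _ _ (Submodule.subset_span ⟨_, rfl⟩)

theorem dirichletMonomial_sub_one {n : ℕ} (hn : 0 < n) (s : RightHalfPlane) :
    dirichletMonomial (n - 1) s = (n : ℂ) ^ (-(s : ℂ)) := by
  change ((n - 1 + 1 : ℕ) : ℂ) ^ (-(s : ℂ)) = _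
  rw [Nat.sub_add_cancel hn]

theorem blockFun_apply (m k : ℕ) (s : RightHalfPlane) :
    blockFun m k s = bohrPoint s (2 * m) * blockPoly k (bohrPoint s) := by
  rw [blockFun, BoundedContinuousFunction.sum_apply, blockPoly, Finset.mul_sum]
  refine Finset.sum_congr rfl fun i _ => ?_
  rw [BoundedContinuousFunction.smul_apply, dirichletMonomial_sub_one (freqMul_pos _),
    freqMul_cpow, freq_cpow, smul_eq_mul]
  ring

theorem bohrPoint_mem_polydisc (s : RightHalfPlane) : bohrPoint s ∈ polydisc :=
  norm_bohrPoint_le_one s.2.le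

theorem norm_blockFun_le (m k : ℕ) : ‖blockFun m k‖ ≤ (1 / 2) ^ (k + 1) := by
  refine (BoundedContinuousFunction.norm_le (by positivity)).2 fun s => ?_
  rw [blockFun_apply, norm_mul]
  exact (mul_le_of_le_one_left (norm_nonneg _) (bohrPoint_mem_polydisc s _)).trans
    (norm_blockPoly_le k (bohrPoint_mem_polydisc s))

theorem hasSum_norm_lp (x : lp (fun _ : ℕ => ℂ) 1) : HasSum (fun m => ‖x m‖) ‖x‖ := by
  simpa using lp.hasSum_norm (p := 1) (by simp) x

theorem hasSum_norm_mul_half_pow (x : lp (fun _ : ℕ => ℂ) 1) :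
    HasSum (fun j : ℕ × ℕ => ‖x j.1‖ * (1 / 2 : ℝ) ^ (j.2 + 1)) ‖x‖ := by
  have hx := hasSum_norm_lp x
  have h := hx.mul (summable_half_pow_succ.hasSum) (hx.summable.mul_of_nonneg
    summable_half_pow_succ (fun _ => norm_nonneg _) fun _ => by positivity)
  rwa [tsum_half_pow_succ, mul_one] at h

theorem norm_smul_blockFun_le (x : lp (fun _ : ℕ => ℂ) 1) (j : ℕ × ℕ) :
    ‖x j.1 • blockFun j.1 j.2‖ ≤ ‖x j.1‖ * (1 / 2 : ℝ) ^ (j.2 + 1) := by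
  rw [norm_smul]
  exact mul_le_mul_of_nonneg_left (norm_blockFun_le _ _) (norm_nonneg _)

theorem summable_smul_blockFun (x : lp (fun _ : ℕ => ℂ) 1) :
    Summable fun j : ℕ × ℕ => x j.1 • blockFun j.1 j.2 :=
  Summable.of_norm_bounded (hasSum_norm_mul_half_pow x).summable (norm_smul_blockFun_le x)

/-- The linear map `x ↦ (∑ x m * r_m ^ (-s)) * (sum of the blocks)`. -/
noncomputable def embedLinear : lp (fun _ : ℕ => ℂ) 1 →ₗ[ℂ] (RightHalfPlane →ᵇ ℂ) where
  toFun x := ∑' j : ℕ × ℕ, x j.1 • blockFun j.1 j.2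
  map_add' x y := by
    rw [← (summable_smul_blockFun x).tsum_add (summable_smul_blockFun y)]
    exact tsum_congr fun j => by rw [lp.coeFn_add, Pi.add_apply, add_smul]
  map_smul' c x := by
    rw [RingHom.id_apply, ← (summable_smul_blockFun x).tsum_const_smul c]
    exact tsum_congr fun j => by rw [lp.coeFn_smul, Pi.smul_apply, smul_eq_mul, mul_smul]

theorem embedLinear_mem (x : lp (fun _ : ℕ => ℂ) 1) : embedLinear x ∈ dirichletAlgebra := by
  refine (Submodule.isClosed_topologicalClosure dirichletPolynomials).mem_of_tendsto
    (summable_smul_blockFun x).hasSum (Eventually.of_forall fun F => ?_)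
  exact Submodule.le_topologicalClosure _ (Submodule.sum_mem _ fun j _ =>
    Submodule.smul_mem _ _ (blockFun_mem _ _))

theorem embedLinear_apply (x : lp (fun _ : ℕ => ℂ) 1) (s : RightHalfPlane) :
    embedLinear x s = evenForm x (bohrPoint s) * blockSum (bohrPoint s) := by
  have hz := bohrPoint_mem_polydisc s
  have h1 : Summable fun m => ‖x m * bohrPoint s (2 * m)‖ :=
    Summable.of_nonneg_of_le (fun _ => norm_nonneg _)
      (fun m => by rw [norm_mul]; exact mul_le_of_le_one_right (norm_nonneg _) (hz _))
      (hasSum_norm_lp x).summable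
  have h2 : Summable fun k => ‖blockPoly k (bohrPoint s)‖ :=
    Summable.of_nonneg_of_le (fun _ => norm_nonneg _) (fun k => norm_blockPoly_le k hz)
      summable_half_pow_succ
  rw [evenForm, blockSum, tsum_mul_tsum_of_summable_norm h1 h2]
  have h3 := (summable_smul_blockFun x).hasSum.mapL (BoundedContinuousFunction.evalCLM ℂ s)
  refine h3.tsum_eq.symm.trans (tsum_congr fun j => ?_)
  change x j.1 • blockFun j.1 j.2 s = _
  rw [blockFun_apply, smul_eq_mul, mul_assoc]

/-- The isometric embedding of `ℓ₁` into `𝒜(ℂ₀)`. -/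
noncomputable def embed : lp (fun _ : ℕ => ℂ) 1 →ₗᵢ[ℂ] dirichletAlgebra where
  toLinearMap := embedLinear.codRestrict dirichletAlgebra embedLinear_mem
  norm_map' x := by
    change ‖embedLinear x‖ = ‖x‖
    refine le_antisymm
      (tsum_of_norm_bounded (hasSum_norm_mul_half_pow x) (norm_smul_blockFun_le x)) ?_
    rw [← (hasSum_norm_lp x).tsum_eq]
    refine tsum_norm_le_of_forall_bohrPoint (hasSum_norm_lp x).summable fun s hs => ?_
    rw [← embedLinear_apply x ⟨s, hs⟩]
    exact (embedLinear x).norm_coe_le_norm _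

/-! ### The Dirichlet series and its abscissa of absolute convergence -/

/-- The Dirichlet coefficients of `embed x`. -/
noncomputable def dirichletCoeff (x : ℕ → ℂ) : ℕ → ℂ :=
  Function.extend freqMul (fun j => x j.1 * coef j.2) 0

theorem dirichletCoeff_freqMul (x : ℕ → ℂ) (j : ℕ × MonomialIndex) :
    dirichletCoeff x (freqMul j) = x j.1 * coef j.2 :=
  freqMul_injective.extend_apply _ _ _

theorem dirichletCoeff_eq_zero (x : ℕ → ℂ) {n : ℕ} (hn : n ∉ Set.range freqMul) :
    dirichletCoeff x n = 0 :=
  Function.extend_apply' _ _ _ fun ⟨j, hj⟩ => hn ⟨j, hj⟩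

theorem LSeriesSummable_dirichletCoeff_iff (x : ℕ → ℂ) (σ : ℝ) :
    LSeriesSummable (dirichletCoeff x) σ ↔ Summable fun j : ℕ × MonomialIndex =>
      (‖x j.1‖ * (prm (2 * j.1) : ℝ) ^ (-σ)) * (‖coef j.2‖ * (freq j.2 : ℝ) ^ (-σ)) := by
  rw [LSeriesSummable, ← freqMul_injective.summable_iff, ← summable_norm_iff]
  · refine summable_congr fun j => ?_
    rw [Function.comp_apply, LSeries.norm_term_eq, if_neg (freqMul_pos j).ne',
      dirichletCoeff_freqMul, norm_mul, Complex.ofReal_re, div_eq_mul_inv,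
      ← Real.rpow_neg (Nat.cast_nonneg _), freqMul, Nat.cast_mul,
      Real.mul_rpow (Nat.cast_nonneg _) (Nat.cast_nonneg _)]
    ring
  · intro n hn
    rw [LSeries.term_def, dirichletCoeff_eq_zero x hn]
    simp

theorem summable_evenForm_bohrPoint (x : lp (fun _ : ℕ => ℂ) 1) {σ : ℝ} (hσ : 0 ≤ σ) :
    Summable fun m => ‖x m‖ * (prm (2 * m) : ℝ) ^ (-σ) :=
  Summable.of_nonneg_of_le (fun _ => by positivity)
    (fun m => mul_le_of_le_one_right (norm_nonneg _) (Real.rpow_le_one_of_one_le_of_nonpos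
      (by exact_mod_cast (prime_prm _).pos) (by linarith)))
    (hasSum_norm_lp x).summable

theorem LSeriesSummable_dirichletCoeff (x : lp (fun _ : ℕ => ℂ) 1) {σ : ℝ} (hσ : 1 / 2 < σ) :
    LSeriesSummable (dirichletCoeff x) σ :=
  (LSeriesSummable_dirichletCoeff_iff x σ).2
    ((summable_evenForm_bohrPoint x (by linarith)).mul_of_nonneg (summable_coef_freq hσ)
      (fun _ => by positivity) fun _ => by positivity)

theorem not_LSeriesSummable_dirichletCoeff {x : lp (fun _ : ℕ => ℂ) 1} (hx : x ≠ 0) {σ : ℝ}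
    (hσ0 : 0 ≤ σ) (hσ : σ < 1 / 2) : ¬ LSeriesSummable (dirichletCoeff x) σ := by
  intro h
  rw [LSeriesSummable_dirichletCoeff_iff] at h
  obtain ⟨m, hm⟩ : ∃ m, x m ≠ 0 := by
    by_contra! hall
    exact hx (lp.ext (funext hall))
  have h1 := h.comp_injective (Prod.mk_right_injective (β := MonomialIndex) m)
  have hc : ‖x m‖ * (prm (2 * m) : ℝ) ^ (-σ) ≠ 0 := by
    have : (0 : ℝ) < prm (2 * m) := by exact_mod_cast (prime_prm _).pos
    have : 0 < (prm (2 * m) : ℝ) ^ (-σ) := Real.rpow_pos_of_pos this _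
    have := norm_pos_iff.2 hm
    positivity
  exact not_summable_coef_freq hσ0 hσ ((summable_mul_left_iff hc).1 h1)

theorem abscissaOfAbsConv_dirichletCoeff {x : lp (fun _ : ℕ => ℂ) 1} (hx : x ≠ 0) :
    LSeries.abscissaOfAbsConv (dirichletCoeff x) = ((1 / 2 : ℝ) : EReal) := by
  refine le_antisymm
    (LSeries.abscissaOfAbsConv_le_of_forall_lt_LSeriesSummable fun y hy =>
      LSeriesSummable_dirichletCoeff x hy) (le_of_not_gt fun hlt => ?_)
  obtain ⟨σ, hσ1, hσ2⟩ := EReal.lt_iff_exists_real_btwn.1 hlt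
  refine not_LSeriesSummable_dirichletCoeff hx (σ := max σ 0) (le_max_right _ _)
    (max_lt (by exact_mod_cast hσ2) (by norm_num))
    (LSeriesSummable_of_abscissaOfAbsConv_lt_re ?_)
  rw [Complex.ofReal_re]
  exact hσ1.trans_le (by exact_mod_cast le_max_left _ _)

theorem hasSum_dirichletCoeff (x : lp (fun _ : ℕ => ℂ) 1) {s : RightHalfPlane}
    (hs : 1 / 2 < (s : ℂ).re) :
    HasSum (fun n : ℕ => dirichletCoeff x n * (n : ℂ) ^ (-(s : ℂ))) (embedLinear x s) := by
  rw [← freqMul_injective.hasSum_iff fun n hn => by rw [dirichletCoeff_eq_zero x hn, zero_mul]]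
  have h1 : Summable fun m => ‖x m * bohrPoint s (2 * m)‖ := by
    refine (summable_evenForm_bohrPoint x s.2.le).congr fun m => ?_
    rw [norm_mul, bohrPoint, Complex.norm_natCast_cpow_of_pos (prime_prm _).pos, Complex.neg_re]
  have h2 : Summable fun j => ‖coef j * (freq j : ℂ) ^ (-(s : ℂ))‖ := by
    refine (summable_coef_freq hs).congr fun j => ?_
    rw [norm_mul, Complex.norm_natCast_cpow_of_pos (freq_pos _), Complex.neg_re]
  have h3 : blockSum (bohrPoint s) = ∑' j, coef j * (freq j : ℂ) ^ (-(s : ℂ)) := by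
    rw [h2.of_norm.tsum_sigma, blockSum]
    refine tsum_congr fun k => ?_
    rw [tsum_fintype, blockPoly]
    exact Finset.sum_congr rfl fun i _ => by rw [freq_cpow]
  have h4 := (summable_mul_of_summable_norm h1 h2).hasSum
  rw [← tsum_mul_tsum_of_summable_norm h1 h2, ← h3] at h4
  rw [embedLinear_apply]
  refine h4.congr_fun fun j => ?_
  rw [Function.comp_apply, dirichletCoeff_freqMul, freqMul_cpow]
  ring

theorem isRepresentedBy_embed (x : lp (fun _ : ℕ => ℂ) 1) :
    IsRepresentedBy (embed x : RightHalfPlane →ᵇ ℂ) (dirichletCoeff x) := by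
  refine ⟨1 / 2, fun s hs => ?_⟩
  have h := (hasSum_dirichletCoeff x hs).tendsto_sum_nat.comp (tendsto_add_atTop_nat 1)
  refine h.congr fun N => ?_
  have h0 : dirichletCoeff x 0 = 0 :=
    dirichletCoeff_eq_zero x fun ⟨j, hj⟩ => (freqMul_pos j).ne' hj
  rw [Function.comp_apply, Finset.range_eq_Ico, Finset.sum_eq_sum_Ico_succ_bot (Nat.succ_pos N),
    h0, zero_mul, zero_add]
  rfl

theorem embed_mem_maximalStrip {x : lp (fun _ : ℕ => ℂ) 1} (hx : x ≠ 0) :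
    embed x ∈ maximalStrip :=
  ⟨dirichletCoeff x, isRepresentedBy_embed x, abscissaOfAbsConv_dirichletCoeff hx⟩

/-! ### Dimensions -/

/-- The geometric sequences are eigenvectors of the backward shift, so they are linearly independent
and `ℓ₁` has at least continuum dimension. -/
theorem continuum_le_rank_lp :
    Cardinal.continuum ≤ Module.rank ℂ (lp (fun _ : ℕ => ℂ) 1) := by
  have hmem : ∀ r : Set.Ioo (0 : ℝ) 1, Memℓp (fun n : ℕ => ((r : ℝ) : ℂ) ^ n) 1 := fun r => by
    refine memℓp_gen ?_
    simpa [abs_of_pos r.2.1] using summable_geometric_of_lt_one r.2.1.le r.2.2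
  let v : Set.Ioo (0 : ℝ) 1 → lp (fun _ : ℕ => ℂ) 1 := fun r => ⟨_, hmem r⟩
  have hli : LinearIndependent ℂ fun (r : Set.Ioo (0 : ℝ) 1) (n : ℕ) => ((r : ℝ) : ℂ) ^ n := by
    refine Module.End.eigenvectors_linearIndependent'
      (LinearMap.funLeft ℂ ℂ Nat.succ : Module.End ℂ (ℕ → ℂ))
      (fun r : Set.Ioo (0 : ℝ) 1 => ((r : ℝ) : ℂ))
      (fun r r' h => Subtype.ext (Complex.ofReal_injective h)) _ fun r => ⟨?_, fun h => ?_⟩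
    · rw [Module.End.mem_eigenspace_iff]
      funext n
      simp [LinearMap.funLeft_apply, pow_succ']
    · simpa using congrFun h 0
  have hv' : LinearIndependent ℂ v := by
    let coe : lp (fun _ : ℕ => ℂ) 1 →ₗ[ℂ] (ℕ → ℂ) :=
      { toFun := fun x => x, map_add' := fun _ _ => rfl, map_smul' := fun _ _ => rfl }
    exact LinearIndependent.of_comp coe hli
  rw [← Cardinal.mk_Ioo_real (show (0 : ℝ) < 1 from one_pos)]
  exact hv'.cardinal_le_rank

/-- Continuous functions are determined by their values on a countable dense set, so `𝒜(ℂ₀)` has at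
most continuum many elements. -/
theorem rank_dirichletAlgebra_le : Module.rank ℂ dirichletAlgebra ≤ Cardinal.continuum := by
  have : Nonempty RightHalfPlane := ⟨⟨1, by simp⟩⟩
  have hinj : Function.Injective fun (f : dirichletAlgebra) (n : ℕ) =>
      (f : RightHalfPlane →ᵇ ℂ) (TopologicalSpace.denseSeq RightHalfPlane n) := fun f g h =>
    Subtype.ext (DFunLike.coe_injective ((TopologicalSpace.denseRange_denseSeq _).equalizer
      (f : RightHalfPlane →ᵇ ℂ).continuous (g : RightHalfPlane →ᵇ ℂ).continuous h))
  refine (rank_le_card ℂ _).trans ((Cardinal.mk_le_of_injective hinj).trans ?_)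
  simp [Cardinal.mk_complex]

theorem range_embed_subset : Set.range embed \ {0} ⊆ maximalStrip := by
  rintro _ ⟨⟨x, rfl⟩, hx⟩
  exact embed_mem_maximalStrip fun h => hx (by rw [h, map_zero]; rfl)

theorem isMaximalSpaceable_maximalStrip : IsMaximalSpaceable ℂ maximalStrip := by
  refine ⟨LinearMap.range embed.toLinearMap, ?_, le_antisymm (Submodule.rank_le _) ?_, ?_⟩
  · exact embed.isometry.isClosedEmbedding.isClosed_range
  · rw [(LinearEquiv.ofInjective embed.toLinearMap embed.injective).symm.rank_eq]
    exact rank_dirichletAlgebra_le.trans continuum_le_rank_lp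
  · rintro _ ⟨x, rfl⟩
    by_cases hx : embed x = 0
    · exact Or.inr hx
    · exact Or.inl (range_embed_subset ⟨⟨x, rfl⟩, hx⟩)

end BohrStrip

theorem theorem1p1 :
    BohrStrip.IsMaximalSpaceable ℂ BohrStrip.maximalStrip ∧
      ∃ T : lp (fun _ : ℕ => ℂ) 1 →ₗᵢ[ℂ] BohrStrip.dirichletAlgebra,
        Set.range T \ {0} ⊆ BohrStrip.maximalStrip :=
  ⟨BohrStrip.isMaximalSpaceable_maximalStrip, BohrStrip.embed, BohrStrip.range_embed_subset⟩
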